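/- Let $E=(E^0,E^1,r,s)$ be a directed graph that is row-finite, i.e. $s^{-1}(v)$ is finite for every $v\in E^0$, and let $K$ be a field. Let $L_K(E)$ be the Leavitt path algebra, i.e. the universal (not necessarily unital) $K$-algebra generated by pairwise orthogonal idempotents $v\in E^0$ and elements $e,e^*$ ($e\in E^1$) with $s(e)e=er(e)=e$, $r(e)e^*=e^*s(e)=e^*$, $e^*f=\delta_{e,f}\,r(e)$, and $v=\sum_{s(e)=v}ee^*$ whenever $s^{-1}(v)$ is nonempty and finite. Let $H\subseteq E^0$ be hereditary (every finite path that starts in $H$ ends in $H$) and saturated (every $v$ with $s^{-1}(v)$ nonempty and finite and $r(s^{-1}(v))\subseteq H$ lies in $H$), and let $I(H)$ be the two-sided ideal of $L_K(E)$ generated by $H$. The quotient graph $E/H$ has vertex set $E^0\setminus H$ and edge set $\{e\in E^1: r(e)\notin H\}$, with the restricted range and source maps. A cycle in a graph is a path $e_1\cdots e_n$ ($n\ge 1$) with $r(e_n)=s(e_1)$ and $s(e_i)\ne s(e_j)$ for $i\neq j$; an exit for it is an edge $e$ with $s(e)=s(e_i)$ and $e\neq e_i$ for some $i$. For a graph $F$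 let $P_c(F)$ be the set of all vertices that lie on cycles of $F$ without exits. Each $v\in P_c(E)\setminus H$ belongs to $P_c(E/H)$, so that $f(v)=v$ defines a map $f\colon P_c(E)\setminus H\to P_c(E/H)$. For a subset $X$ of an algebra $A$ put $X^\perp=\{a\in A: ax=xa=0\text{ for all }x\in X\}$. If $I(H)$ is regular, i.e. $I(H)=I(H)^{\perp\perp}$ in $L_K(E)$, then $f\colon P_c(E)\setminus H\to P_c(E/H)$ is a bijection. -/

import Mathlib

universe u v w x

/-- A directed graph with vertex set `V`, edge set `Ed`, source map `s` and range map `r`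
(parallel edges and loops are allowed). -/
structure DirGraph (V : Type u) (Ed : Type v) where
  s : Ed → V
  r : Ed → V

namespace DirGraph

variable {V : Type u} {Ed : Type v}

/-- `s⁻¹(v)` is finite for every vertex `v`. -/
def RowFinite (E : DirGraph V Ed) : Prop :=
  ∀ v : V, {e : Ed | E.s e = v}.Finite

/-- `v` is a regular vertex: `s⁻¹(v)` is nonempty and finite. -/
def IsRegularVertex (E : DirGraph V Ed) (v : V) : Prop :=
  {e : Ed | E.s e = v}.Nonempty ∧ {e : Ed | E.s e = v}.Finite

/-- `E.IsPath v α w`: the list of edges `α` is a finite path of `E` with source `v` and range `w`.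
The empty list is the trivial path at any vertex. -/
def IsPath (E : DirGraph V Ed) : V → List Ed → V → Prop
  | v, [], w => v = w
  | v, e :: α, w => E.s e = v ∧ E.IsPath (E.r e) α w

/-- `H` is hereditary: a path that starts in `H` ends in `H`. -/
def Hereditary (E : DirGraph V Ed) (H : Set V) : Prop :=
  ∀ (v w : V) (α : List Ed), E.IsPath v α w → v ∈ H → w ∈ H

/-- `H` is saturated: a regular vertex all of whose edges end in `H` is in `H`. -/
def Saturated (E : DirGraph V Ed) (H : Set V) : Prop :=
  ∀ v : V, E.IsRegularVertex v → E.r '' {e : Ed | E.s e = v} ⊆ H → v ∈ H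

/-- `α = e₁ … eₙ` (`n ≥ 1`) is a cycle: a path from some vertex to itself whose edges have
pairwise distinct sources. -/
def IsCycle (E : DirGraph V Ed) (α : List Ed) : Prop :=
  α ≠ [] ∧ (∃ v, E.IsPath v α v) ∧ (α.map E.s).Nodup

/-- `e` is an exit for `α = e₁ … eₙ`: for some `i`, `s(e) = s(eᵢ)` and `e ≠ eᵢ`. -/
def IsExit (E : DirGraph V Ed) (α : List Ed) (e : Ed) : Prop :=
  ∃ f ∈ α, E.s e = E.s f ∧ e ≠ f

/-- The set `α⁰` of vertices of a path of positive length. -/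
def pathVertices (E : DirGraph V Ed) (α : List Ed) : Set V :=
  {v | ∃ e ∈ α, v = E.r e ∨ v = E.s e}

/-- `P_c(E)`: the vertices on cycles without exits. -/
def Pc (E : DirGraph V Ed) : Set V :=
  {v | ∃ α : List Ed, E.IsCycle α ∧ (¬ ∃ e, E.IsExit α e) ∧ v ∈ E.pathVertices α}

/-- The quotient graph `E/H` by a hereditary set `H`: its vertices are those outside `H`, its edges
those whose range is outside `H`. -/
def quotient (E : DirGraph V Ed) (H : Set V) (hH : E.Hereditary H) :
    DirGraph {v : V // v ∉ H} {e : Ed // E.r e ∉ H} where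
  s e := ⟨E.s e.1, fun h => e.2 (hH _ _ [e.1] ⟨rfl, rfl⟩ h)⟩
  r e := ⟨E.r e.1, e.2⟩

/-! ### The map `P_c(E) \ H → P_c(E/H)`, `v ↦ v` -/

theorem IsPath.source_reaches {E : DirGraph V Ed} {α : List Ed} :
    ∀ {v w : V}, E.IsPath v α w → ∀ e ∈ α, ∃ β γ : List Ed,
      E.IsPath v β (E.s e) ∧ E.IsPath (E.r e) γ w := by
  induction α with
  | nil => intro v w _ e he; simp at he
  | cons f α ih =>
    rintro v w ⟨hf, hα⟩ e he
    rcases List.mem_cons.1 he with rfl | he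
    · exact ⟨[], α, hf.symm, hα⟩
    · obtain ⟨β, γ, hβ, hγ⟩ := ih hα e he
      exact ⟨f :: β, γ, ⟨hf, hβ⟩, hγ⟩

/-- If one vertex of a closed path is in a hereditary set, then so are all of them. -/
theorem Hereditary.closed_path {E : DirGraph V Ed} {H : Set V} (hH : E.Hereditary H)
    {α : List Ed} {u : V} (hα : E.IsPath u α u) {v : V} (hv : v ∈ E.pathVertices α) (hvH : v ∈ H) :
    ∀ e ∈ α, E.r e ∈ H := by
  intro e he
  obtain ⟨f, hf, hvf⟩ := hv
  obtain ⟨β, γ, _, hγ⟩ := hα.source_reaches f hf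
  obtain ⟨β', γ', hβ', _⟩ := hα.source_reaches e he
  have h1 : E.r f ∈ H := by
    rcases hvf with rfl | rfl
    · exact hvH
    · exact hH _ _ [f] ⟨rfl, rfl⟩ hvH
  have h2 : u ∈ H := hH _ _ γ hγ h1
  have h3 : E.s e ∈ H := hH _ _ β' hβ' h2
  exact hH _ _ [e] ⟨rfl, rfl⟩ h3

theorem isPath_quotient {E : DirGraph V Ed} {H : Set V} (hH : E.Hereditary H)
    (α : List {e : Ed // E.r e ∉ H}) :
    ∀ (v w : {v : V // v ∉ H}), E.IsPath v.1 (α.map Subtype.val) w.1 →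
      (E.quotient H hH).IsPath v α w := by
  induction α with
  | nil => intro v w h; exact Subtype.ext h
  | cons e α ih => rintro v w ⟨h1, h2⟩; exact ⟨Subtype.ext h1, ih ⟨E.r e.1, e.2⟩ w h2⟩

theorem mem_Pc_quotient (E : DirGraph V Ed) (H : Set V) (hH : E.Hereditary H) (v : V)
    (hv : v ∈ E.Pc) (hvH : v ∉ H) : (⟨v, hvH⟩ : {v : V // v ∉ H}) ∈ (E.quotient H hH).Pc := by
  obtain ⟨α, ⟨hne, ⟨u, hu⟩, hnd⟩, hex, hvα⟩ := hv
  have hr : ∀ e ∈ α, E.r e ∉ H := fun e he h =>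
    hvH (by
      have hall := hH.closed_path hu (v := E.r e) ⟨e, he, Or.inl rfl⟩ h
      obtain ⟨f, hf, rfl | rfl⟩ := hvα
      · exact hall f hf
      · obtain ⟨β, _, hβ, _⟩ := hu.source_reaches f hf
        obtain ⟨_, γ, _, hγ⟩ := hu.source_reaches e he
        exact hH _ _ β hβ (hH _ _ γ hγ (hall e he)))
  obtain ⟨β, rfl⟩ : ∃ β : List {e : Ed // E.r e ∉ H}, β.map Subtype.val = α :=
    ⟨α.attachWith _ hr, by simp⟩
  have huH : u ∉ H := by
    intro h
    obtain ⟨e, he⟩ := List.exists_mem_of_ne_nil _ hne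
    obtain ⟨δ, _, hδ, _⟩ := hu.source_reaches e he
    exact hr e he (hH _ _ [e] ⟨rfl, rfl⟩ (hH _ _ δ hδ h))
  refine ⟨β, ⟨fun h => hne (by rw [h, List.map_nil]), ⟨⟨u, huH⟩, isPath_quotient hH β _ _ hu⟩, ?_⟩, ?_, ?_⟩
  · refine List.Nodup.of_map Subtype.val ?_
    rw [List.map_map] at hnd ⊢
    exact hnd
  · rintro ⟨e, f, hf, hs, hef⟩
    exact hex ⟨e.1, f.1, List.mem_map_of_mem hf, congrArg Subtype.val hs,
      fun h => hef (Subtype.ext h)⟩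
  · obtain ⟨e, he, hve⟩ := hvα
    obtain ⟨f, hf, rfl⟩ := List.mem_map.1 he
    exact ⟨f, hf, hve.imp Subtype.ext Subtype.ext⟩

/-- The map `f : P_c(E) \ H → P_c(E/H)`, `f(v) = v`. -/
def pcMap (E : DirGraph V Ed) (H : Set V) (hH : E.Hereditary H) :
    ↥(E.Pc \ H) → ↥(E.quotient H hH).Pc :=
  fun v => ⟨⟨v.1, v.2.2⟩, E.mem_Pc_quotient H hH v.1 v.2.1 v.2.2⟩

/-! ### The Leavitt path algebra -/

/-- The symbols `v`, `e`, `e*` that generate the Leavitt path algebra. -/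
inductive LeavittGen (V : Type u) (Ed : Type v) : Type (max u v)
  | vertex : V → LeavittGen V Ed
  | edge : Ed → LeavittGen V Ed
  | ghost : Ed → LeavittGen V Ed

/-- The elements `g (vertex v)`, `g (edge e)`, `g (ghost e)` of the (not necessarily unital) ring `B`
satisfy the relations of the Leavitt path algebra of `E`. -/
structure IsLeavittFamily (E : DirGraph V Ed) {B : Type x} [NonUnitalRing B]
    (g : LeavittGen V Ed → B) : Prop where
  idem : ∀ v, g (.vertex v) * g (.vertex v) = g (.vertex v)
  orth : ∀ v w, v ≠ w → g (.vertex v) * g (.vertex w) = 0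
  source_edge : ∀ e, g (.vertex (E.s e)) * g (.edge e) = g (.edge e)
  edge_range : ∀ e, g (.edge e) * g (.vertex (E.r e)) = g (.edge e)
  range_ghost : ∀ e, g (.vertex (E.r e)) * g (.ghost e) = g (.ghost e)
  ghost_source : ∀ e, g (.ghost e) * g (.vertex (E.s e)) = g (.ghost e)
  ghost_edge_self : ∀ e, g (.ghost e) * g (.edge e) = g (.vertex (E.r e))
  ghost_edge_ne : ∀ e f, e ≠ f → g (.ghost e) * g (.edge f) = 0
  vertex_eq_sum : ∀ (v : V) (hv : E.IsRegularVertex v),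
    g (.vertex v) = ∑ e ∈ hv.2.toFinset, g (.edge e) * g (.ghost e)

open FreeAlgebra in
/-- The defining relations, imposed on the free unital `K`-algebra on the generators. -/
inductive LeavittRel (K : Type w) [Field K] (E : DirGraph V Ed) :
    FreeAlgebra K (LeavittGen V Ed) → FreeAlgebra K (LeavittGen V Ed) → Prop
  | idem (v : V) : LeavittRel K E (ι K (.vertex v) * ι K (.vertex v)) (ι K (.vertex v))
  | orth (v w : V) (h : v ≠ w) : LeavittRel K E (ι K (.vertex v) * ι K (.vertex w)) 0
  | source_edge (e : Ed) : LeavittRel K E (ι K (.vertex (E.s e)) * ι K (.edge e)) (ι K (.edge e))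
  | edge_range (e : Ed) : LeavittRel K E (ι K (.edge e) * ι K (.vertex (E.r e))) (ι K (.edge e))
  | range_ghost (e : Ed) :
      LeavittRel K E (ι K (.vertex (E.r e)) * ι K (.ghost e)) (ι K (.ghost e))
  | ghost_source (e : Ed) :
      LeavittRel K E (ι K (.ghost e) * ι K (.vertex (E.s e))) (ι K (.ghost e))
  | ghost_edge_self (e : Ed) :
      LeavittRel K E (ι K (.ghost e) * ι K (.edge e)) (ι K (.vertex (E.r e)))
  | ghost_edge_ne (e f : Ed) (h : e ≠ f) : LeavittRel K E (ι K (.ghost e) * ι K (.edge f)) 0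
  | vertex_eq_sum (v : V) (hv : E.IsRegularVertex v) :
      LeavittRel K E (ι K (.vertex v)) (∑ e ∈ hv.2.toFinset, ι K (.edge e) * ι K (.ghost e))

/-- The unital `K`-algebra with the generators and relations of the Leavitt path algebra. It is the
unitization of the Leavitt path algebra, which sits in it as the subalgebra without unit that is
generated by the symbols. -/
abbrev UnitalLeavitt (K : Type w) [Field K] (E : DirGraph V Ed) : Type (max u v w) :=
  RingQuot (LeavittRel K E)

/-- The image of a generator in the unital algebra. -/
def unitalGen (K : Type w) [Field K] (E : DirGraph V Ed) (a : LeavittGen V Ed) :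
    UnitalLeavitt K E :=
  RingQuot.mkAlgHom K (LeavittRel K E) (FreeAlgebra.ι K a)

/-- The Leavitt path algebra `L_K(E)`, as a (not necessarily unital) `K`-algebra. Its universal
property is `isLeavittFamily_gen` with `existsUnique_lift`. -/
abbrev LeavittPathAlgebra (K : Type w) [Field K] (E : DirGraph V Ed) : Type (max u v w) :=
  ↥(NonUnitalAlgebra.adjoin K (Set.range (unitalGen K E)))

/-- The generators `v`, `e`, `e*` as elements of `L_K(E)`. -/
def gen (K : Type w) [Field K] (E : DirGraph V Ed) (a : LeavittGen V Ed) :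
    LeavittPathAlgebra K E :=
  ⟨unitalGen K E a, NonUnitalAlgebra.subset_adjoin K ⟨a, rfl⟩⟩

theorem isLeavittFamily_unitalGen (K : Type w) [Field K] (E : DirGraph V Ed) :
    E.IsLeavittFamily (unitalGen K E) := by
  have key : ∀ {a b}, LeavittRel K E a b →
      RingQuot.mkAlgHom K (LeavittRel K E) a = RingQuot.mkAlgHom K (LeavittRel K E) b :=
    fun h => RingQuot.mkAlgHom_rel K h
  refine ⟨fun v => ?_, fun v w h => ?_, fun e => ?_, fun e => ?_, fun e => ?_, fun e => ?_,
    fun e => ?_, fun e f h => ?_, fun v hv => ?_⟩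
  · simpa [unitalGen] using key (.idem v)
  · simpa [unitalGen] using key (.orth v w h)
  · simpa [unitalGen] using key (.source_edge e)
  · simpa [unitalGen] using key (.edge_range e)
  · simpa [unitalGen] using key (.range_ghost e)
  · simpa [unitalGen] using key (.ghost_source e)
  · simpa [unitalGen] using key (.ghost_edge_self e)
  · simpa [unitalGen] using key (.ghost_edge_ne e f h)
  · simpa [unitalGen] using key (.vertex_eq_sum v hv)

theorem isLeavittFamily_gen (K : Type w) [Field K] (E : DirGraph V Ed) :
    E.IsLeavittFamily (gen K E) := by
  have h := isLeavittFamily_unitalGen K E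
  exact ⟨fun v => Subtype.ext (h.idem v), fun v w hvw => Subtype.ext (h.orth v w hvw),
    fun e => Subtype.ext (h.source_edge e), fun e => Subtype.ext (h.edge_range e),
    fun e => Subtype.ext (h.range_ghost e), fun e => Subtype.ext (h.ghost_source e),
    fun e => Subtype.ext (h.ghost_edge_self e), fun e f hef => Subtype.ext (h.ghost_edge_ne e f hef),
    fun v hv => Subtype.ext (by
      rw [AddSubmonoidClass.coe_finsetSum]
      exact h.vertex_eq_sum v hv)⟩

/-- A family in a unital algebra extends to the unital algebra of the relations. -/
theorem exists_unitalLift (K : Type w) [Field K] (E : DirGraph V Ed) {B : Type x} [Ring B]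
    [Algebra K B] (g : LeavittGen V Ed → B) (hg : E.IsLeavittFamily g) :
    ∃ φ : UnitalLeavitt K E →ₐ[K] B, ∀ a, φ (unitalGen K E a) = g a := by
  have hrel : ∀ ⦃a b⦄, LeavittRel K E a b → FreeAlgebra.lift K g a = FreeAlgebra.lift K g b := by
    intro a b h
    cases h with
    | idem v => simpa using hg.idem v
    | orth v w h => simpa using hg.orth v w h
    | source_edge e => simpa using hg.source_edge e
    | edge_range e => simpa using hg.edge_range e
    | range_ghost e => simpa using hg.range_ghost e
    | ghost_source e => simpa using hg.ghost_source e
    | ghost_edge_self e => simpa using hg.ghost_edge_self e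
    | ghost_edge_ne e f h => simpa using hg.ghost_edge_ne e f h
    | vertex_eq_sum v hv => simpa using hg.vertex_eq_sum v hv
  exact ⟨RingQuot.liftAlgHom K ⟨FreeAlgebra.lift K g, hrel⟩, fun a => by simp [unitalGen]⟩

/-- The universal property of `L_K(E)` among all associative `K`-algebras, unital or not. -/
theorem existsUnique_lift (K : Type w) [Field K] (E : DirGraph V Ed) {B : Type x} [NonUnitalRing B]
    [Module K B] [IsScalarTower K B B] [SMulCommClass K B B] (g : LeavittGen V Ed → B)
    (hg : E.IsLeavittFamily g) :
    ∃! φ : LeavittPathAlgebra K E →ₙₐ[K] B, ∀ a, φ (gen K E a) = g a := by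
  let j : B →ₙₐ[K] Unitization K B := Unitization.inrNonUnitalAlgHom K B
  have hj : Function.Injective j := Unitization.inr_injective
  have hjg : E.IsLeavittFamily (fun a => j (g a)) := by
    refine ⟨fun v => ?_, fun v w h => ?_, fun e => ?_, fun e => ?_, fun e => ?_, fun e => ?_,
      fun e => ?_, fun e f h => ?_, fun v hv => ?_⟩
    · rw [← map_mul, hg.idem]
    · rw [← map_mul, hg.orth v w h, map_zero]
    · rw [← map_mul, hg.source_edge]
    · rw [← map_mul, hg.edge_range]
    · rw [← map_mul, hg.range_ghost]
    · rw [← map_mul, hg.ghost_source]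
    · rw [← map_mul, hg.ghost_edge_self]
    · rw [← map_mul, hg.ghost_edge_ne e f h, map_zero]
    · simp only [← map_mul]
      rw [hg.vertex_eq_sum v hv, map_sum]
  obtain ⟨Φ, hΦ⟩ := exists_unitalLift K E _ hjg
  have hmem : ∀ a : LeavittPathAlgebra K E, ∃ b : B, j b = Φ a.1 := by
    rintro ⟨a, ha⟩
    induction ha using NonUnitalAlgebra.adjoin_induction with
    | mem x hx => obtain ⟨y, rfl⟩ := hx; exact ⟨g y, (hΦ y).symm⟩
    | add x y _ _ hx hy =>
      obtain ⟨b, hb⟩ := hx; obtain ⟨c, hc⟩ := hy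
      exact ⟨b + c, by simp only [map_add, hb, hc]⟩
    | zero => exact ⟨0, by simp only [map_zero]⟩
    | mul x y _ _ hx hy =>
      obtain ⟨b, hb⟩ := hx; obtain ⟨c, hc⟩ := hy
      exact ⟨b * c, by simp only [map_mul, hb, hc]⟩
    | smul k x _ hx =>
      obtain ⟨b, hb⟩ := hx
      exact ⟨k • b, by simp only [map_smul, hb]⟩
  choose φ hφ using hmem
  refine ⟨{ toFun := φ
            map_smul' := fun k a => hj ?_
            map_zero' := hj ?_
            map_add' := fun a b => hj ?_
            map_mul' := fun a b => hj ?_ }, fun a => hj ?_, ?_⟩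
  · rw [hφ]; exact (map_smul Φ k a.1).trans (by rw [← hφ]; exact (map_smul j k (φ a)).symm)
  · rw [hφ, map_zero]; exact map_zero Φ
  · rw [hφ, map_add, hφ, hφ]; exact map_add Φ a.1 b.1
  · rw [hφ, map_mul, hφ, hφ]; exact map_mul Φ a.1 b.1
  · exact (hφ _).trans (hΦ a)
  · intro ψ hψ
    ext ⟨a, ha⟩
    refine hj ?_
    refine Eq.trans ?_ (hφ ⟨a, ha⟩).symm
    induction ha using NonUnitalAlgebra.adjoin_induction with
    | mem x hx => obtain ⟨y, rfl⟩ := hx; exact (congrArg j (hψ y)).trans (hΦ y).symm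
    | add x y hx' hy' hx hy =>
      have : ψ ⟨x + y, add_mem hx' hy'⟩ = ψ ⟨x, hx'⟩ + ψ ⟨y, hy'⟩ := map_add ψ ⟨x, hx'⟩ ⟨y, hy'⟩
      rw [this, map_add, hx, hy]; exact (map_add Φ x y).symm
    | zero => exact (congrArg j (map_zero ψ)).trans ((map_zero j).trans (map_zero Φ).symm)
    | mul x y hx' hy' hx hy =>
      have : ψ ⟨x * y, mul_mem hx' hy'⟩ = ψ ⟨x, hx'⟩ * ψ ⟨y, hy'⟩ := map_mul ψ ⟨x, hx'⟩ ⟨y, hy'⟩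
      rw [this, map_mul, hx, hy]; exact (map_mul Φ x y).symm
    | smul k x hx' hx =>
      have : ψ ⟨k • x, SMulMemClass.smul_mem k hx'⟩ = k • ψ ⟨x, hx'⟩ := map_smul ψ k ⟨x, hx'⟩
      rw [this, map_smul, hx]; exact (map_smul Φ k x).symm

end DirGraph

/-! ### Ideals and regular ideals of an algebra -/

section Ideals

variable (K : Type w) [Field K] {A : Type x} [NonUnitalRing A] [Module K A]

/-- A `K`-subspace `J` of the (not necessarily unital) `K`-algebra `A` is a two-sided ideal. -/
def IsAlgIdeal (J : Submodule K A) : Prop :=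
  ∀ a x : A, x ∈ J → a * x ∈ J ∧ x * a ∈ J

/-- The two-sided ideal of `A` generated by `X`: the smallest one that contains `X`. -/
def algIdealSpan (X : Set A) : Submodule K A :=
  sInf {J : Submodule K A | IsAlgIdeal K J ∧ X ⊆ J}

/-- `X^⊥`, the two-sided annihilator of a subset `X` of `A`. -/
def algPerp (X : Set A) : Set A :=
  {a | ∀ x ∈ X, a * x = 0 ∧ x * a = 0}

/-- `J` is a regular ideal: an ideal with `J = J^⊥⊥`. -/
def IsRegularIdeal (J : Submodule K A) : Prop :=
  IsAlgIdeal K J ∧ (J : Set A) = algPerp (algPerp (J : Set A))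

end Ideals

/-- `I(H)`: the ideal of `L_K(E)` generated by the vertices in `H`. -/
def DirGraph.vertexIdeal {V : Type u} {Ed : Type v} (K : Type w) [Field K] (E : DirGraph V Ed)
    (H : Set V) : Submodule K (DirGraph.LeavittPathAlgebra K E) :=
  algIdealSpan K ((fun v => DirGraph.gen K E (.vertex v)) '' H)

namespace DirGraph

variable {V : Type u} {Ed : Type v}

/-! ### Representations with nonzero vertices -/

/-! Only surjectivity needs an argument. A cycle of `E/H` without exits is a cycle of `E` all of
whose exits lead into `H`. Suppose there is such an exit `e`, rotate the cycle to a closed path `β`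
based at `v = s(e)`, and let `c` be its product in the algebra. It suffices to show that `v`
annihilates `I(H)^⊥` on both sides: regularity then puts `v` in `I(H)`, hence in `H`
(`mem_of_vertex_mem_vertexIdeal`), a contradiction.

Let `a` annihilate `I(H)`. Enough factors `c` absorb all ghost edges of `a`, so `a v c^n` is a
combination of paths ending at `v` for some `n` (`exists_iterate_mem_pathSpan`). It is killed by
right multiplication with `e = e r(e)`, an element of `I(H)`. On such combinations this
multiplication is injective, because a path that follows `e` into `H` never returns to `v`
(`eq_zero_of_mul_edge_eq_zero`). So `a v c^n = 0`. The factors `c` can be removed again, since `a c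
c* = a v`: the terms of exits die against `a` (`mul_pathElem_mul_ghostElem`). Hence `a v = 0`, and
`v a = 0` is the same statement in the opposite algebra. -/

/-- The space `ℕ → K` is a direct sum of copies of itself indexed by a nonempty finite set. -/
theorem exists_branching_maps (K : Type w) [Field K] {ι : Type v} (s : Finset ι)
    (hs : s.Nonempty) :
    ∃ a b : ι → Module.End K (ℕ → K),
      (∀ e ∈ s, b e * a e = 1) ∧ (∀ e ∈ s, ∀ f ∈ s, e ≠ f → b e * a f = 0) ∧
      ∑ e ∈ s, a e * b e = 1 := by
  classical
  obtain ⟨i, hi⟩ := hs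
  have : Nonempty s := ⟨⟨i, hi⟩⟩
  -- The bijection cuts `ℕ` into infinite blocks indexed by `s`; `a e` writes a sequence on block
  -- `e` and `b e` reads it back.
  obtain ⟨ψ⟩ : Nonempty ((s × ℕ) ≃ ℕ) := nonempty_equiv_of_countable
  let a : ι → Module.End K (ℕ → K) := fun e =>
    { toFun := fun x m => if ((ψ.symm m).1 : ι) = e then x (ψ.symm m).2 else 0
      map_add' := fun x y => by ext m; by_cases h : ((ψ.symm m).1 : ι) = e <;> simp [h]
      map_smul' := fun k x => by ext m; by_cases h : ((ψ.symm m).1 : ι) = e <;> simp [h] }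
  let b : ι → Module.End K (ℕ → K) := fun e =>
    { toFun := fun x n => if h : e ∈ s then x (ψ (⟨e, h⟩, n)) else 0
      map_add' := fun x y => by ext m; by_cases h : e ∈ s <;> simp [h]
      map_smul' := fun k x => by ext m; by_cases h : e ∈ s <;> simp [h] }
  refine ⟨a, b, fun e he => ?_, fun e he f hf hef => ?_, ?_⟩
  · refine LinearMap.ext fun x => funext fun n => ?_
    simp [a, b, he]
  · refine LinearMap.ext fun x => funext fun n => ?_
    simp [a, b, he, hef]
  · refine LinearMap.ext fun x => funext fun n => ?_
    simp only [LinearMap.sum_apply, Finset.sum_apply, Module.End.mul_apply, Module.End.one_apply]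
    rw [Finset.sum_eq_single ((ψ.symm n).1 : ι)]
    · simp [a, b]
    · intro e _ hne
      simp [a, hne.symm]
    · intro h
      exact absurd (ψ.symm n).1.2 h

/-- A row-finite graph has a Leavitt family of linear operators with all vertices nonzero. -/
theorem RowFinite.exists_leavittFamily (K : Type w) [Field K] {E : DirGraph V Ed}
    (hE : E.RowFinite) :
    ∃ g : LeavittGen V Ed → Module.End K (V → ℕ → K),
      E.IsLeavittFamily g ∧ ∀ v, g (.vertex v) ≠ 0 := by
  classical
  have key : ∀ v, ∃ a b : Ed → Module.End K (ℕ → K),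
      (∀ e, E.s e = v → b e * a e = 1) ∧
      (∀ e f, E.s e = v → E.s f = v → e ≠ f → b e * a f = 0) ∧
      (E.IsRegularVertex v → ∑ e ∈ (hE v).toFinset, a e * b e = 1) := by
    intro v
    by_cases hv : {e : Ed | E.s e = v}.Nonempty
    · obtain ⟨a, b, h1, h2, h3⟩ := exists_branching_maps K (hE v).toFinset (by simpa using hv)
      exact ⟨a, b, fun e he => h1 e (by simpa using he),
        fun e f he hf => h2 e (by simpa using he) f (by simpa using hf), fun _ => h3⟩
    · have hv' : ∀ e, E.s e ≠ v := fun e he => hv ⟨e, he⟩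
      exact ⟨0, 0, fun e he => (hv' e he).elim, fun e f he => (hv' e he).elim,
        fun h => (hv h.1).elim⟩
  choose a b hba hba' hab using key
  let σ : V → (ℕ → K) →ₗ[K] (V → ℕ → K) := fun v => LinearMap.single K (fun _ => ℕ → K) v
  let π : V → (V → ℕ → K) →ₗ[K] (ℕ → K) := fun v => LinearMap.proj v
  have hπσ : ∀ v x, π v (σ v x) = x := fun v x => by simp [π, σ]
  have hπσ' : ∀ v w x, v ≠ w → π v (σ w x) = 0 := fun v w x h => by simp [π, σ, h]
  -- Each vertex owns one copy of `ℕ → K`, and `e` embeds the copy at `r(e)` as block `e` of the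
  -- copy at `s(e)`.
  let g : LeavittGen V Ed → Module.End K (V → ℕ → K)
    | .vertex v => σ v ∘ₗ π v
    | .edge e => σ (E.s e) ∘ₗ a (E.s e) e ∘ₗ π (E.r e)
    | .ghost e => σ (E.r e) ∘ₗ b (E.s e) e ∘ₗ π (E.s e)
  refine ⟨g, ⟨fun v => ?_, fun v w h => ?_, fun e => ?_, fun e => ?_, fun e => ?_, fun e => ?_,
    fun e => ?_, fun e f h => ?_, fun v hv => ?_⟩, fun v hv => ?_⟩
  iterate 6
    refine LinearMap.ext fun x => ?_
    simp_all [g]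
  · refine LinearMap.ext fun x => ?_
    have := LinearMap.congr_fun (hba _ e rfl) (π (E.r e) x)
    simp only [Module.End.mul_apply, Module.End.one_apply] at this
    simp [g, hπσ, this]
  · refine LinearMap.ext fun x => ?_
    by_cases hs : E.s e = E.s f
    · have := LinearMap.congr_fun (hba' _ e f hs rfl h) (π (E.r f) x)
      simp only [Module.End.mul_apply, LinearMap.zero_apply] at this
      simp [g, hs, hπσ, this]
    · simp [g, hπσ' _ _ _ hs]
  · refine LinearMap.ext fun x => ?_
    have h1 := LinearMap.congr_fun (hab v hv) (π v x)
    simp only [LinearMap.sum_apply, Module.End.mul_apply, Module.End.one_apply] at h1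
    have h2 : ∀ e ∈ (hE v).toFinset, (g (.edge e) * g (.ghost e)) x
        = σ v (a v e (b v e (π v x))) := by
      intro e he
      obtain rfl : E.s e = v := by simpa using he
      simp [g, hπσ]
    rw [LinearMap.sum_apply, Finset.sum_congr rfl h2, ← map_sum, h1]
    rfl
  · have := congrArg (π v) (LinearMap.congr_fun hv (σ v 1))
    simp only [g, LinearMap.comp_apply, hπσ, LinearMap.zero_apply, map_zero] at this
    exact one_ne_zero this

/-! ### Extension by zero from `E/H`, and the vertices of `I(H)` -/

theorem RowFinite.quotient {E : DirGraph V Ed} (hE : E.RowFinite) {H : Set V}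
    (hH : E.Hereditary H) : (E.quotient H hH).RowFinite := by
  intro v
  refine ((hE v.1).preimage (f := Subtype.val) Subtype.val_injective.injOn).subset ?_
  intro e he
  exact congrArg Subtype.val he

/-- Extension by zero of a family indexed by the generators of a quotient graph. -/
noncomputable def extendGen (E : DirGraph V Ed) (H : Set V) {B : Type x} [Zero B]
    (g : LeavittGen {v : V // v ∉ H} {e : Ed // E.r e ∉ H} → B) : LeavittGen V Ed → B := by
  classical
  exact fun
    | .vertex v => if h : v ∉ H then g (.vertex ⟨v, h⟩) else 0
    | .edge e => if h : E.r e ∉ H then g (.edge ⟨e, h⟩) else 0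
    | .ghost e => if h : E.r e ∉ H then g (.ghost ⟨e, h⟩) else 0

/-- A Leavitt family of `E/H` extends by zero to one of `E`. -/
theorem IsLeavittFamily.extendGen {E : DirGraph V Ed} {H : Set V} {hH : E.Hereditary H}
    (hS : E.Saturated H) {B : Type x} [NonUnitalRing B]
    {g : LeavittGen {v : V // v ∉ H} {e : Ed // E.r e ∉ H} → B}
    (hg : (E.quotient H hH).IsLeavittFamily g) : E.IsLeavittFamily (E.extendGen H g) := by
  classical
  have hs : ∀ e, E.r e ∉ H → E.s e ∉ H := fun e he h => he (hH _ _ [e] ⟨rfl, rfl⟩ h)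
  refine ⟨fun v => ?_, fun v w h => ?_, fun e => ?_, fun e => ?_, fun e => ?_, fun e => ?_,
    fun e => ?_, fun e f h => ?_, fun v hv => ?_⟩
  · by_cases hv : v ∈ H
    · simp [DirGraph.extendGen, hv]
    · simpa [DirGraph.extendGen, hv] using hg.idem ⟨v, hv⟩
  · by_cases hv : v ∈ H
    · simp [DirGraph.extendGen, hv]
    by_cases hw : w ∈ H
    · simp [DirGraph.extendGen, hw]
    simpa [DirGraph.extendGen, hv, hw] using
      hg.orth ⟨v, hv⟩ ⟨w, hw⟩ (fun h' => h (congrArg Subtype.val h'))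
  · by_cases he : E.r e ∈ H
    · simp [DirGraph.extendGen, he]
    · simpa [DirGraph.extendGen, he, hs e he, DirGraph.quotient] using hg.source_edge ⟨e, he⟩
  · by_cases he : E.r e ∈ H
    · simp [DirGraph.extendGen, he]
    · simpa [DirGraph.extendGen, he, DirGraph.quotient] using hg.edge_range ⟨e, he⟩
  · by_cases he : E.r e ∈ H
    · simp [DirGraph.extendGen, he]
    · simpa [DirGraph.extendGen, he, DirGraph.quotient] using hg.range_ghost ⟨e, he⟩
  · by_cases he : E.r e ∈ H
    · simp [DirGraph.extendGen, he]
    · simpa [DirGraph.extendGen, he, hs e he, DirGraph.quotient] using hg.ghost_source ⟨e, he⟩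
  · by_cases he : E.r e ∈ H
    · simp [DirGraph.extendGen, he]
    · simpa [DirGraph.extendGen, he, DirGraph.quotient] using hg.ghost_edge_self ⟨e, he⟩
  · by_cases he : E.r e ∈ H
    · simp [DirGraph.extendGen, he]
    by_cases hf : E.r f ∈ H
    · simp [DirGraph.extendGen, hf]
    simpa [DirGraph.extendGen, he, hf] using
      hg.ghost_edge_ne ⟨e, he⟩ ⟨f, hf⟩ (fun h' => h (congrArg Subtype.val h'))
  · by_cases hvH : v ∈ H
    · rw [Finset.sum_eq_zero]
      · simp [DirGraph.extendGen, hvH]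
      · intro e he
        have he' : E.s e = v := by simpa using he
        have : E.r e ∈ H := hH _ _ [e] ⟨he', rfl⟩ hvH
        simp [DirGraph.extendGen, this]
    -- Saturation keeps a regular vertex outside `H` from becoming a sink of `E/H`, where its sum
    -- relation would be lost.
    · have hreg : (E.quotient H hH).IsRegularVertex ⟨v, hvH⟩ := by
        constructor
        · by_contra hne
          refine hvH (hS v hv ?_)
          rintro _ ⟨e, he, rfl⟩
          by_contra her
          exact hne ⟨⟨e, her⟩, Subtype.ext he⟩
        · refine (hv.2.preimage (f := Subtype.val) Subtype.val_injective.injOn).subset ?_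
          intro e he
          exact congrArg Subtype.val he
      have h1 := hg.vertex_eq_sum ⟨v, hvH⟩ hreg
      have h2 : E.extendGen H g (.vertex v) = g (.vertex ⟨v, hvH⟩) := by
        simp [DirGraph.extendGen, hvH]
      rw [h2, h1]
      refine Finset.sum_of_injOn Subtype.val Subtype.val_injective.injOn ?_ ?_ ?_
      · intro e he
        have he' : (E.quotient H hH).s e = ⟨v, hvH⟩ := by simpa using he
        simpa [DirGraph.quotient] using congrArg Subtype.val he'
      · intro e he hne
        have he' : E.s e = v := by simpa using he
        by_cases her : E.r e ∈ H
        · simp [DirGraph.extendGen, her]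
        · refine absurd ⟨⟨e, her⟩, ?_, rfl⟩ hne
          simpa using Subtype.ext he'
      · intro e _
        simp [DirGraph.extendGen, e.2]

/-- The vertices in `I(H)` are those of `H`. -/
theorem mem_of_vertex_mem_vertexIdeal (K : Type w) [Field K] {E : DirGraph V Ed}
    (hE : E.RowFinite) {H : Set V} (hH : E.Hereditary H) (hS : E.Saturated H) {v : V}
    (hv : gen K E (.vertex v) ∈ E.vertexIdeal K H) : v ∈ H := by
  by_contra hvH
  obtain ⟨g, hg, hg0⟩ := (hE.quotient hH).exists_leavittFamily K
  obtain ⟨φ, hφ, -⟩ := existsUnique_lift K E _ (hg.extendGen hS)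
  -- The kernel of `φ` is an ideal that contains `H`, whereas `φ` is nonzero on the vertices outside
  -- `H`.
  let J : Submodule K (LeavittPathAlgebra K E) :=
    { carrier := {a | φ a = 0}
      add_mem' := fun {a b} (ha : φ a = 0) (hb : φ b = 0) => by
        change φ (a + b) = 0
        rw [map_add, ha, hb, add_zero]
      zero_mem' := map_zero φ
      smul_mem' := fun k a (ha : φ a = 0) => by
        change φ (k • a) = 0
        rw [map_smul, ha, smul_zero] }
  have hJ : E.vertexIdeal K H ≤ J := by
    refine sInf_le ⟨fun a y (hy : φ y = 0) => ⟨?_, ?_⟩, ?_⟩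
    · change φ (a * y) = 0
      rw [map_mul, hy, mul_zero]
    · change φ (y * a) = 0
      rw [map_mul, hy, zero_mul]
    · rintro _ ⟨w, hw, rfl⟩
      change φ (gen K E (.vertex w)) = 0
      rw [hφ]
      simp [extendGen, hw]
  have h0 : φ (gen K E (.vertex v)) = 0 := hJ hv
  rw [hφ] at h0
  exact hg0 ⟨v, hvH⟩ (by simpa [extendGen, hvH] using h0)

theorem RowFinite.vertex_ne_zero (K : Type w) [Field K] {E : DirGraph V Ed}
    (hE : E.RowFinite) (v : V) : gen K E (.vertex v) ≠ 0 := by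
  obtain ⟨g, hg, hg0⟩ := hE.exists_leavittFamily K
  obtain ⟨φ, hφ, -⟩ := existsUnique_lift K E _ hg
  intro h
  exact hg0 v (by rw [← hφ, h, map_zero])

/-! ### Products along paths -/

section Paths

variable {K : Type w} [Field K] {A : Type x} [NonUnitalRing A] [Module K A]
  {E : DirGraph V Ed} {g : LeavittGen V Ed → A}

theorem IsPath.append {α β : List Ed} : ∀ {u v w : V}, E.IsPath u α v → E.IsPath v β w →
    E.IsPath u (α ++ β) w := by
  induction α with
  | nil => rintro u v w rfl h; exact h
  | cons e α ih => rintro u v w ⟨h1, h2⟩ h; exact ⟨h1, ih h2 h⟩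

theorem IsPath.split {α β : List Ed} : ∀ {u w : V}, E.IsPath u (α ++ β) w →
    ∃ v, E.IsPath u α v ∧ E.IsPath v β w := by
  induction α with
  | nil => intro u w h; exact ⟨u, rfl, h⟩
  | cons e α ih =>
    rintro u w ⟨h1, h2⟩
    obtain ⟨v, h3, h4⟩ := ih h2
    exact ⟨v, ⟨h1, h3⟩, h4⟩

/-- The product `e₁ ⋯ eₙ v`. -/
def pathElem (g : LeavittGen V Ed → A) (v : V) : List Ed → A
  | [] => g (.vertex v)
  | e :: α => g (.edge e) * pathElem g v α

/-- The product `v eₙ* ⋯ e₁*`. -/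
def ghostElem (g : LeavittGen V Ed → A) (v : V) : List Ed → A
  | [] => g (.vertex v)
  | e :: α => ghostElem g v α * g (.ghost e)

namespace IsLeavittFamily

variable (hg : E.IsLeavittFamily g)
include hg

theorem source_mul_pathElem {α : List Ed} {u v : V} (h : E.IsPath u α v) :
    g (.vertex u) * pathElem g v α = pathElem g v α := by
  cases α with
  | nil => obtain rfl : u = v := h; exact hg.idem u
  | cons e α =>
    obtain ⟨rfl, -⟩ := h
    rw [pathElem, ← mul_assoc, hg.source_edge]

theorem pathElem_mul {α β : List Ed} {v w : V} (hβ : E.IsPath v β w) :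
    pathElem g v α * pathElem g w β = pathElem g w (α ++ β) := by
  induction α with
  | nil => exact hg.source_mul_pathElem hβ
  | cons e α ih => rw [pathElem, mul_assoc, ih]; rfl

theorem pathElem_mul_range (α : List Ed) (v : V) :
    pathElem g v α * g (.vertex v) = pathElem g v α := by
  simpa [pathElem] using hg.pathElem_mul (α := α) (β := []) (v := v) (w := v) rfl

theorem ghostElem_mul_pathElem_self {α : List Ed} :
    ∀ {u v : V}, E.IsPath u α v → ghostElem g v α * pathElem g v α = g (.vertex v) := by
  induction α with
  | nil => intro u v _; exact hg.idem v
  | cons e α ih =>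
    rintro u v ⟨-, h⟩
    rw [ghostElem, pathElem, mul_assoc, ← mul_assoc (g (.ghost e)), hg.ghost_edge_self,
      hg.source_mul_pathElem h, ih h]

/-- Unless `β` extends `α`, the two differ at some edge and `α* β` vanishes; the length bound
excludes a leftover ghost path. If `β` extends `α`, the remainder cannot start with `e`, since it
would enter `H` and yet end at `v`, so `e*` kills it. -/
theorem ghost_mul_ghostElem_mul_pathElem {H : Set V} (hH : E.Hereditary H) {v : V} (hv : v ∉ H)
    {e : Ed} (hse : E.s e = v) (hre : E.r e ∈ H) {α : List Ed} :
    ∀ {β : List Ed} {u : V}, E.IsPath u β v → α.length ≤ β.length → α ≠ β →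
      g (.ghost e) * (ghostElem g v α * pathElem g v β) = 0 := by
  induction α with
  | nil =>
    intro β u hβ _ hne
    cases β with
    | nil => exact absurd rfl hne
    | cons f β =>
      have hef : e ≠ f := by
        rintro rfl
        exact hv (hH _ _ β hβ.2 hre)
      rw [ghostElem, pathElem, ← mul_assoc, ← hse, hg.ghost_source, ← mul_assoc,
        hg.ghost_edge_ne e f hef, zero_mul]
  | cons f α ih =>
    intro β u hβ hle hne
    cases β with
    | nil => simp at hle
    | cons f' β =>
      rw [ghostElem, pathElem, mul_assoc (ghostElem g v α), ← mul_assoc (g (.ghost f))]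
      by_cases hf : f = f'
      · subst hf
        rw [hg.ghost_edge_self, hg.source_mul_pathElem hβ.2]
        exact ih hβ.2 (by simpa using hle) (fun h => hne (by rw [h]))
      · rw [hg.ghost_edge_ne _ _ hf, zero_mul, mul_zero, mul_zero]

end IsLeavittFamily

/-! ### Spans of paths ending at a vertex -/

variable (K E) in
/-- The span of the paths that end at `v`. -/
def pathSpan (g : LeavittGen V Ed → A) (v : V) : Submodule K A :=
  Submodule.span K (pathElem g v '' {α | ∃ u, E.IsPath u α v})

theorem pathElem_mem_pathSpan {α : List Ed} {u v : V} (h : E.IsPath u α v) :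
    pathElem g v α ∈ pathSpan K E g v :=
  Submodule.subset_span ⟨α, ⟨u, h⟩, rfl⟩

variable [IsScalarTower K A A] [SMulCommClass K A A]

namespace IsLeavittFamily

variable (hg : E.IsLeavittFamily g)
include hg

/-- Multiplication on the right by an edge from a vertex outside `H` into `H` is injective on the
span of the paths that end at that vertex. -/
theorem eq_zero_of_mul_edge_eq_zero {H : Set V} (hH : E.Hereditary H) {v : V} (hv : v ∉ H)
    {e : Ed} (hse : E.s e = v) (hre : E.r e ∈ H) (hne : g (.vertex (E.r e)) ≠ 0) {y : A}
    (hy : y ∈ pathSpan K E g v) (hye : y * g (.edge e) = 0) : y = 0 := by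
  classical
  obtain ⟨l, hl, rfl⟩ := (Finsupp.mem_span_image_iff_linearCombination K).1 hy
  by_contra hl0
  have hsup : l.support.Nonempty := by
    rw [Finset.nonempty_iff_ne_empty]
    intro h
    rw [Finsupp.support_eq_empty] at h
    exact hl0 (by rw [h, map_zero])
  -- For a shortest path `α` of the support, `e* α*` kills every other term and isolates the
  -- coefficient of `α`.
  obtain ⟨α, hα, hmin⟩ := Finset.exists_min_image l.support List.length hsup
  have hpath : ∀ β ∈ l.support, ∃ u, E.IsPath u β v := fun β hβ => hl hβ
  have hsum : g (.ghost e) * (ghostElem g v α * Finsupp.linearCombination K (pathElem g v) l)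
      = l α • g (.ghost e) := by
    rw [Finsupp.linearCombination_apply, Finsupp.sum, Finset.mul_sum, Finset.mul_sum,
      Finset.sum_eq_single α]
    · obtain ⟨u, hu⟩ := hpath α hα
      rw [mul_smul_comm, mul_smul_comm, hg.ghostElem_mul_pathElem_self hu, ← hse, hg.ghost_source]
    · intro β hβ hβα
      obtain ⟨u, hu⟩ := hpath β hβ
      rw [mul_smul_comm, mul_smul_comm,
        hg.ghost_mul_ghostElem_mul_pathElem hH hv hse hre hu (hmin β hβ) hβα.symm, smul_zero]
    · intro h
      exact absurd hα h
  have h0 : l α • g (.vertex (E.r e)) = 0 := by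
    rw [← hg.ghost_edge_self e, ← smul_mul_assoc, ← hsum, mul_assoc, mul_assoc, hye, mul_zero,
      mul_zero]
  exact (smul_ne_zero (Finsupp.mem_support_iff.1 hα) hne) h0

omit [IsScalarTower K A A] in
theorem vertex_mul_mem_pathSpan (w : V) {v : V} {y : A} (hy : y ∈ pathSpan K E g v) :
    g (.vertex w) * y ∈ pathSpan K E g v := by
  induction hy using Submodule.span_induction with
  | mem y hy =>
    obtain ⟨α, ⟨u, hα⟩, rfl⟩ := hy
    rw [← hg.source_mul_pathElem hα, ← mul_assoc]
    by_cases h : w = u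
    · subst h
      rw [hg.idem, hg.source_mul_pathElem hα]
      exact pathElem_mem_pathSpan hα
    · rw [hg.orth _ _ h, zero_mul]
      exact zero_mem _
  | zero => rw [mul_zero]; exact zero_mem _
  | add y z _ _ hy hz => rw [mul_add]; exact add_mem hy hz
  | smul k y _ hy => rw [mul_smul_comm]; exact Submodule.smul_mem _ k hy

omit [IsScalarTower K A A] in
theorem edge_mul_mem_pathSpan (e : Ed) {v : V} {y : A} (hy : y ∈ pathSpan K E g v) :
    g (.edge e) * y ∈ pathSpan K E g v := by
  induction hy using Submodule.span_induction with
  | mem y hy =>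
    obtain ⟨α, ⟨u, hα⟩, rfl⟩ := hy
    by_cases h : E.r e = u
    · subst h
      exact pathElem_mem_pathSpan (α := e :: α) ⟨rfl, hα⟩
    · rw [← hg.source_mul_pathElem hα, ← mul_assoc, ← hg.edge_range, mul_assoc (g (.edge e)),
        hg.orth _ _ h, mul_zero, zero_mul]
      exact zero_mem _
  | zero => rw [mul_zero]; exact zero_mem _
  | add y z _ _ hy hz => rw [mul_add]; exact add_mem hy hz
  | smul k y _ hy => rw [mul_smul_comm]; exact Submodule.smul_mem _ k hy

omit [SMulCommClass K A A] in
theorem mul_pathElem_mem_pathSpan {v : V} {β : List Ed} (hβ : E.IsPath v β v) {y : A}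
    (hy : y ∈ pathSpan K E g v) : y * pathElem g v β ∈ pathSpan K E g v := by
  induction hy using Submodule.span_induction with
  | mem y hy =>
    obtain ⟨α, ⟨u, hα⟩, rfl⟩ := hy
    rw [hg.pathElem_mul hβ]
    exact pathElem_mem_pathSpan (hα.append hβ)
  | zero => rw [zero_mul]; exact zero_mem _
  | add y z _ _ hy hz => rw [add_mul]; exact add_mem hy hz
  | smul k y _ hy => rw [smul_mul_assoc]; exact Submodule.smul_mem _ k hy

/-- Since `β` is nonempty, every path `α β` has a first edge, which `e*` either cancels or
annihilates; on a trivial path `e*` would survive. -/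
theorem ghost_mul_mul_pathElem_mem_pathSpan (e : Ed) {v : V} {β : List Ed} (hβ : E.IsPath v β v)
    (hne : β ≠ []) {y : A} (hy : y ∈ pathSpan K E g v) :
    g (.ghost e) * (y * pathElem g v β) ∈ pathSpan K E g v := by
  induction hy using Submodule.span_induction with
  | mem y hy =>
    obtain ⟨α, ⟨u, hα⟩, rfl⟩ := hy
    rw [hg.pathElem_mul hβ]
    have hαβ := hα.append hβ
    obtain ⟨f, γ, hγ⟩ := List.exists_cons_of_ne_nil (List.append_ne_nil_of_right_ne_nil α hne)
    rw [hγ] at hαβ ⊢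
    rw [pathElem, ← mul_assoc]
    by_cases h : e = f
    · subst h
      rw [hg.ghost_edge_self, hg.source_mul_pathElem hαβ.2]
      exact pathElem_mem_pathSpan hαβ.2
    · rw [hg.ghost_edge_ne _ _ h, zero_mul]
      exact zero_mem _
  | zero => rw [zero_mul, mul_zero]; exact zero_mem _
  | add y z _ _ hy hz => rw [add_mul, mul_add]; exact add_mem hy hz
  | smul k y _ hy => rw [smul_mul_assoc, mul_smul_comm]; exact Submodule.smul_mem _ k hy

/-- Right multiplication by a high enough power of a closed path at `v` brings every element of
`A v` into the span of the paths that end at `v`. -/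
theorem exists_iterate_mem_pathSpan
    (hgen : ∀ M : Submodule K A, (∀ z, ∀ y ∈ M, g z * y ∈ M) → ∀ a, ∀ y ∈ M, a * y ∈ M)
    {v : V} {β : List Ed} (hβ : E.IsPath v β v) (hne : β ≠ []) (a : A) :
    ∃ n : ℕ, (· * pathElem g v β)^[n] (a * g (.vertex v)) ∈ pathSpan K E g v := by
  -- The algebra need not have a unit, so iterated right multiplication by `c` replaces powers of
  -- `c`.
  set c := pathElem g v β
  have hmono : ∀ (m n : ℕ) (y : A), m ≤ n → (· * c)^[m] y ∈ pathSpan K E g v →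
      (· * c)^[n] y ∈ pathSpan K E g v := by
    intro m n y hmn hy
    induction n, hmn using Nat.le_induction with
    | base => exact hy
    | succ n _ ih =>
      rw [Function.iterate_succ_apply']
      exact hg.mul_pathElem_mem_pathSpan hβ ih
  have hadd : ∀ (n : ℕ) (y z : A), (· * c)^[n] (y + z) = (· * c)^[n] y + (· * c)^[n] z := by
    intro n
    induction n with
    | zero => intro y z; rfl
    | succ n ih => intro y z; simp only [Function.iterate_succ_apply, add_mul, ih]
  have hsmul : ∀ (n : ℕ) (k : K) (y : A), (· * c)^[n] (k • y) = k • (· * c)^[n] y := by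
    intro n
    induction n with
    | zero => intro k y; rfl
    | succ n ih => intro k y; simp only [Function.iterate_succ_apply, smul_mul_assoc, ih]
  have hmul : ∀ (n : ℕ) (b y : A), (· * c)^[n] (b * y) = b * (· * c)^[n] y := by
    intro n
    induction n with
    | zero => intro b y; rfl
    | succ n ih => intro b y; simp only [Function.iterate_succ_apply, mul_assoc, ih]
  -- `M` contains `v` and is stable under left multiplication by generators, a ghost edge costing
  -- one more factor `c`; so `hgen` puts every `a v` in `M`.
  let M : Submodule K A :=
    { carrier := {y | ∃ n : ℕ, (· * c)^[n] y ∈ pathSpan K E g v}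
      add_mem' := by
        rintro y z ⟨m, hm⟩ ⟨n, hn⟩
        refine ⟨max m n, ?_⟩
        rw [hadd]
        exact add_mem (hmono m _ y (le_max_left m n) hm) (hmono n _ z (le_max_right m n) hn)
      zero_mem' := ⟨0, zero_mem (pathSpan K E g v)⟩
      smul_mem' := by
        rintro k y ⟨n, hn⟩
        exact ⟨n, by rw [hsmul]; exact Submodule.smul_mem _ k hn⟩ }
  refine hgen M ?_ a (g (.vertex v)) ⟨0, pathElem_mem_pathSpan (α := []) (u := v) rfl⟩
  rintro z y ⟨n, hn⟩
  cases z with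
  | vertex w => exact ⟨n, by rw [hmul]; exact hg.vertex_mul_mem_pathSpan w hn⟩
  | edge e => exact ⟨n, by rw [hmul]; exact hg.edge_mul_mem_pathSpan e hn⟩
  | ghost e =>
    refine ⟨n + 1, ?_⟩
    rw [hmul, Function.iterate_succ_apply']
    exact hg.ghost_mul_mul_pathElem_mem_pathSpan e hβ hne hn

/-! ### Annihilators of the ideal generated by `H` -/

omit [Module K A] [IsScalarTower K A A] [SMulCommClass K A A] in
/-- If all exits of a path lead into `H`, then `a β β* = a u` for every `a` in the left annihilator
of the ideal generated by `H`. -/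
theorem mul_pathElem_mul_ghostElem (hE : E.RowFinite) {H : Set V} {β : List Ed}
    (hexit : ∀ e ∈ β, ∀ f, E.s f = E.s e → f ≠ e → E.r f ∈ H) :
    ∀ {u v : V}, E.IsPath u β v → ∀ a : A, (∀ b, ∀ h ∈ H, a * (b * g (.vertex h)) = 0) →
      a * pathElem g v β * ghostElem g v β = a * g (.vertex u) := by
  induction β with
  | nil =>
    rintro u v rfl a _
    rw [pathElem, ghostElem, mul_assoc, hg.idem]
  | cons e β ih =>
    rintro u v ⟨rfl, hβ⟩ a ha
    have hreg : E.IsRegularVertex (E.s e) := ⟨⟨e, rfl⟩, hE _⟩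
    -- With `a`, also `a e` annihilates, so induction applies to the rest of the path.
    have h1 : a * g (.edge e) * pathElem g v β * ghostElem g v β
        = a * g (.edge e) * g (.vertex (E.r e)) := by
      refine ih (fun e he => hexit e (List.mem_cons_of_mem _ he)) hβ _ fun b h hh => ?_
      have := ha (g (.edge e) * b) h hh
      simpa only [mul_assoc] using this
    rw [pathElem, ghostElem, ← mul_assoc, ← mul_assoc, h1, mul_assoc a, hg.edge_range,
      hg.vertex_eq_sum _ hreg, Finset.mul_sum, Finset.sum_eq_single e]
    · rw [mul_assoc]
    -- Here `f` is an exit, so `a f = a f r(f) = 0`.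
    · intro f hf hfe
      have hs : E.s f = E.s e := by simpa using hf
      rw [← hg.edge_range, ← mul_assoc, ha _ _ (hexit e List.mem_cons_self f hs hfe), zero_mul]
    · intro h
      exact absurd (by simp) h

/-- Let `v ∉ H` be the base of a closed path whose exits all lead into `H`, with at least one exit
at `v`. Then `a v = 0` for every `a` that annihilates the ideal generated by `H` from the left. -/
theorem mul_vertex_eq_zero (hE : E.RowFinite) {H : Set V} (hH : E.Hereditary H)
    (hgen : ∀ M : Submodule K A, (∀ z, ∀ y ∈ M, g z * y ∈ M) → ∀ a, ∀ y ∈ M, a * y ∈ M)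
    {v : V} (hv : v ∉ H) {β : List Ed} (hβ : E.IsPath v β v) (hne : β ≠ [])
    (hexit : ∀ e ∈ β, ∀ f, E.s f = E.s e → f ≠ e → E.r f ∈ H)
    {e : Ed} (hse : E.s e = v) (hre : E.r e ∈ H) (h0 : g (.vertex (E.r e)) ≠ 0) {a : A}
    (ha : ∀ b, ∀ h ∈ H, a * (b * g (.vertex h)) = 0) : a * g (.vertex v) = 0 := by
  obtain ⟨n, hn⟩ := hg.exists_iterate_mem_pathSpan hgen hβ hne a
  induction n generalizing a with
  | zero =>
    refine hg.eq_zero_of_mul_edge_eq_zero hH hv hse hre h0 hn ?_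
    have := ha (g (.edge e)) _ hre
    rw [hg.edge_range] at this
    rw [mul_assoc, ← hse, hg.source_edge, this]
  -- Induction applies to `a c`, which still annihilates and needs one factor `c` less. It gives `a
  -- c = 0`, and then `a v = a c c* = 0`.
  | succ n ih =>
    have h1 : a * pathElem g v β * g (.vertex v) = 0 := by
      refine ih (fun b h hh => ?_) ?_
      · rw [mul_assoc, ← mul_assoc _ b]
        exact ha _ h hh
      · rw [Function.iterate_succ_apply] at hn
        convert hn using 2
        rw [mul_assoc, mul_assoc, hg.pathElem_mul_range, hg.source_mul_pathElem hβ]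
    rw [mul_assoc, hg.pathElem_mul_range] at h1
    rw [← hg.mul_pathElem_mul_ghostElem hE hexit hβ a ha, h1, zero_mul]

end IsLeavittFamily

end Paths

/-! ### The opposite family -/

/-- The family with the roles of edges and ghost edges exchanged, in the opposite algebra. -/
def opGen {A : Type x} (g : LeavittGen V Ed → A) : LeavittGen V Ed → Aᵐᵒᵖ
  | .vertex v => .op (g (.vertex v))
  | .edge e => .op (g (.ghost e))
  | .ghost e => .op (g (.edge e))

/-- The relations are invariant under exchanging `e` with `e*` and reversing products; this turns
left annihilation results into right ones. -/
theorem IsLeavittFamily.op {E : DirGraph V Ed} {A : Type x} [NonUnitalRing A]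
    {g : LeavittGen V Ed → A} (hg : E.IsLeavittFamily g) : E.IsLeavittFamily (opGen g) where
  idem v := congrArg MulOpposite.op (hg.idem v)
  orth v w h := congrArg MulOpposite.op (hg.orth w v h.symm)
  source_edge e := congrArg MulOpposite.op (hg.ghost_source e)
  edge_range e := congrArg MulOpposite.op (hg.range_ghost e)
  range_ghost e := congrArg MulOpposite.op (hg.edge_range e)
  ghost_source e := congrArg MulOpposite.op (hg.source_edge e)
  ghost_edge_self e := congrArg MulOpposite.op (hg.ghost_edge_self e)
  ghost_edge_ne e f h := congrArg MulOpposite.op (hg.ghost_edge_ne f e h.symm)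
  vertex_eq_sum v hv := by
    have := congrArg MulOpposite.op (hg.vertex_eq_sum v hv)
    rw [Finset.op_sum] at this
    exact this

/-- This supplies `hgen` for `L_K(E)`: the left multipliers that preserve `M` form a subalgebra. -/
theorem mul_mem_of_gen_mul_mem {K : Type w} [Field K] {E : DirGraph V Ed}
    (M : Submodule K (LeavittPathAlgebra K E))
    (hM : ∀ z, ∀ y ∈ M, gen K E z * y ∈ M) (a : LeavittPathAlgebra K E) :
    ∀ y ∈ M, a * y ∈ M := by
  obtain ⟨a, ha⟩ := a
  induction ha using NonUnitalAlgebra.adjoin_induction with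
  | mem a ha => obtain ⟨z, rfl⟩ := ha; exact hM z
  | add a b ha' hb' ha hb =>
    intro y hy
    have := add_mem (ha y hy) (hb y hy)
    rwa [← add_mul] at this
  | zero => intro y hy; convert zero_mem M; exact zero_mul y
  | mul a b ha' hb' ha hb =>
    intro y hy
    have := ha _ (hb y hy)
    rwa [← mul_assoc] at this
  | smul k a ha' ha =>
    intro y hy
    have := M.smul_mem k (ha y hy)
    rwa [← smul_mul_assoc] at this

theorem mul_mem_of_opGen_mul_mem {K : Type w} [Field K] {E : DirGraph V Ed}
    (M : Submodule K (LeavittPathAlgebra K E)ᵐᵒᵖ)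
    (hM : ∀ z, ∀ y ∈ M, opGen (gen K E) z * y ∈ M) (a : (LeavittPathAlgebra K E)ᵐᵒᵖ) :
    ∀ y ∈ M, a * y ∈ M := by
  induction a using MulOpposite.rec' with | _ a
  obtain ⟨a, ha⟩ := a
  induction ha using NonUnitalAlgebra.adjoin_induction with
  | mem a ha =>
    obtain ⟨z, rfl⟩ := ha
    cases z with
    | vertex v => exact hM (.vertex v)
    | edge e => exact hM (.ghost e)
    | ghost e => exact hM (.edge e)
  | add a b ha' hb' ha hb =>
    intro y hy
    have := add_mem (ha y hy) (hb y hy)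
    rwa [← add_mul] at this
  | zero => intro y hy; convert zero_mem M; exact zero_mul y
  | mul a b ha' hb' ha hb =>
    intro y hy
    -- In the opposite algebra the factors of `a * b` act in reverse order.
    have := hb _ (ha y hy)
    rwa [← mul_assoc] at this
  | smul k a ha' ha =>
    intro y hy
    have := M.smul_mem k (ha y hy)
    rwa [← smul_mul_assoc] at this

/-! ### Cycles of the quotient graph -/

theorem IsPath.of_quotient {E : DirGraph V Ed} {H : Set V} {hH : E.Hereditary H}
    {α : List {e : Ed // E.r e ∉ H}} : ∀ {v w : {v : V // v ∉ H}},
      (E.quotient H hH).IsPath v α w → E.IsPath v.1 (α.map Subtype.val) w.1 := by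
  induction α with
  | nil => intro v w h; exact congrArg Subtype.val h
  | cons e α ih => rintro v w ⟨h1, h2⟩; exact ⟨congrArg Subtype.val h1, ih h2⟩

theorem vertex_mem_vertexIdeal (K : Type w) [Field K] (E : DirGraph V Ed) {H : Set V} {h : V}
    (hh : h ∈ H) : gen K E (.vertex h) ∈ E.vertexIdeal K H :=
  Submodule.mem_sInf.2 fun _ hJ => hJ.2 ⟨h, hh, rfl⟩

/-- If `I(H)` is regular, a closed path outside `H` all of whose exits lead into `H` has no edge into `H` at
its base. -/
theorem range_notMem_of_isRegularIdeal {K : Type w} [Field K] {E : DirGraph V Ed}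
    (hE : E.RowFinite) {H : Set V} (hH : E.Hereditary H) (hS : E.Saturated H)
    (hreg : IsRegularIdeal K (A := LeavittPathAlgebra K E) (E.vertexIdeal K H))
    {v : V} (hv : v ∉ H) {β : List Ed} (hβ : E.IsPath v β v) (hne : β ≠ [])
    (hexit : ∀ e ∈ β, ∀ f, E.s f = E.s e → f ≠ e → E.r f ∈ H)
    {e : Ed} (hse : E.s e = v) : E.r e ∉ H := by
  intro hre
  refine hv (mem_of_vertex_mem_vertexIdeal K hE hH hS ?_)
  have h0 := hE.vertex_ne_zero K (E.r e)
  -- By regularity it suffices that `v` annihilates every `y` in `I(H)^⊥`; `v y = 0` is proved in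
  -- the opposite algebra.
  rw [← SetLike.mem_coe, hreg.2]
  intro y hy
  constructor
  · have := (isLeavittFamily_gen K E).op.mul_vertex_eq_zero hE hH mul_mem_of_opGen_mul_mem hv hβ
      hne hexit hse hre (fun h => h0 (MulOpposite.op_injective h)) (a := .op y) ?_
    · exact MulOpposite.op_injective this
    · intro b h hh
      refine congrArg MulOpposite.op (hy (gen K E (.vertex h) * b.unop) ?_).2
      exact (hreg.1 b.unop _ (vertex_mem_vertexIdeal K E hh)).2
  · refine (isLeavittFamily_gen K E).mul_vertex_eq_zero hE hH mul_mem_of_gen_mul_mem hv hβ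
      hne hexit hse hre h0 ?_
    intro b h hh
    exact (hy _ (hreg.1 b _ (vertex_mem_vertexIdeal K E hh)).1).1

end DirGraph

theorem proposition3p8 {V : Type u} {Ed : Type v} (K : Type w) [Field K] (E : DirGraph V Ed)
    (hE : E.RowFinite) (H : Set V) (hH : E.Hereditary H) (hS : E.Saturated H)
    (hreg : IsRegularIdeal K (A := DirGraph.LeavittPathAlgebra K E) (E.vertexIdeal K H)) :
    Function.Bijective (E.pcMap H hH) := by
  refine ⟨fun v w h => Subtype.ext (congrArg (fun z => z.1.1) h), ?_⟩
  rintro ⟨⟨v, hvH⟩, α, ⟨hne, ⟨u, hu⟩, hnd⟩, hex, hvα⟩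
  suffices hv : v ∈ E.Pc from ⟨⟨v, hv, hvH⟩, rfl⟩
  have hpath := hu.of_quotient
  -- An exit with range outside `H` would already be an exit in `E/H`.
  have hexit : ∀ e ∈ α.map Subtype.val, ∀ f, E.s f = E.s e → f ≠ e → E.r f ∈ H := by
    intro e he f hs hfe
    obtain ⟨e', he', rfl⟩ := List.mem_map.1 he
    by_contra hf
    exact hex ⟨⟨f, hf⟩, e', he', Subtype.ext hs, fun h => hfe (congrArg Subtype.val h)⟩
  refine ⟨α.map Subtype.val, ⟨fun h => hne (List.map_eq_nil_iff.1 h), ⟨u.1, hpath⟩, ?_⟩, ?_, ?_⟩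
  · have := hnd.map Subtype.val_injective
    rw [List.map_map] at this ⊢
    exact this
  · rintro ⟨e, f, hf, hs, hef⟩
    have hre := hexit f hf e hs hef
    have hsf : E.s f ∉ H := by
      obtain ⟨f, _, rfl⟩ := List.mem_map.1 hf
      exact ((E.quotient H hH).s f).2
    -- The cycle `γ f δ` is rotated to `f δ γ`, so that it is based at the source of the exit `e`.
    obtain ⟨γ, δ, hγδ⟩ := List.append_of_mem hf
    rw [hγδ] at hpath hexit
    obtain ⟨t, hγ, rfl, hδ⟩ := hpath.split
    refine DirGraph.range_notMem_of_isRegularIdeal hE hH hS hreg hsf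
      (β := f :: (δ ++ γ)) ⟨rfl, hδ.append hγ⟩ (List.cons_ne_nil _ _) ?_ hs hre
    intro e' he'
    refine hexit e' ?_
    simp only [List.mem_cons, List.mem_append] at he' ⊢
    tauto
  · obtain ⟨e, he, hve⟩ := hvα
    exact ⟨e.1, List.mem_map_of_mem he, hve.imp (congrArg Subtype.val) (congrArg Subtype.val)⟩
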